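/- For $n,m\ge 0$ let $\mathrm{IMS2}(n,m)$ be the set of integer arrays $A[0..n-1][0..n-1]$ with $0\le A[i][j]<m$, $A[i][j]\le A[i][j+1]$ and $A[i][j]\le A[i+1][j]$ for all indices in range. For $A\in\mathrm{IMS2}(n,m)$, pad $A$ by the value $-1$ at negative indices and by $m$ at indices $\ge n$. For $0\le k<m$ the $k$-th boundary of $A$ is the set of edges of the $(n+1)\times(n+1)$ grid graph on $\{0,\dots,n\}^2$ consisting of the edges $\{(i,j),(i+1,j)\}$ with $A[i][j-1]<k\le A[i][j]$ and the edges $\{(i,j),(i,j+1)\}$ with $A[i-1][j]<k\le A[i][j]$. **Theorem.** There are a word-RAM program $P$ and constants $c,C,T$ such that for all $n,m$, every word size $w$ with $2^w\ge c\,nm$ (i.e. $w\ge\log_2(nm)+O(1)$) and every $A\in\mathrm{IMS2}(n,m)$ there is a bit string $D$ (the data structure) of length at most $C\,nm$ with the following properties. 1. Given a column number $0\le r<n$ and a value $0\le h<2^w$ (and $n,m,w$), the program $P$, with read-only access to $D$ stored in $w$-bit words, outputs $\min\{x : A[r][x]\ge h\}$ (and outputs $n$ if there is no such $x$) after at most $T$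 instructions. 2. $D$ contains, as a contiguous block, the concatenation $B_0B_1\cdots B_{m-1}$, where $B_k$ is the $2n$-bit vector that encodes the $k$-th boundary as a monotone lattice path from $(0,n)$ to $(n,0)$: bit $1$ is a step $(i,j)\to(i+1,j)$ and bit $0$ is a step $(i,j)\to(i,j-1)$. In terms of these vectors, for $0\le h<m$, the answer to the query $(r,h)$ is $n-\mathrm{rank}_0(\mathrm{select}_1(r+1,B_h),B_h)$, where $\mathrm{rank}_c(p,B)$ is the number of bits $c$ among the first $p$ bits of $B$ and $\mathrm{select}_c(i,B)=\min\{p:\mathrm{rank}_c(p,B)=i\}$. The word RAM has finitely many $w$-bit registers in use, the operations $+,-,\times$ modulo $2^w$, integer division and remainder, bitwise and/or/xor, shifts, comparison, reading a memory word, and (conditional) jumps, each at unit cost; $P,c,C,T$ do not depend on $n,m,w,A$. -/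

import Mathlib

/-! ### Doubly monotone arrays, their boundaries, and the bit-vectors of the boundaries -/

/-- `IMS2 n m`: the `n × n` arrays `A[0..n-1][0..n-1]` with integer entries in `[0, m)` that are
nondecreasing in each of the two indices. The first index is called the column number. -/
def IMS2 (n m : ℕ) : Set (Fin n → Fin n → ℕ) :=
  {A | (∀ (i j : Fin n) (hj : (j : ℕ) + 1 < n), A i j ≤ A i ⟨j + 1, hj⟩) ∧
       (∀ (i j : Fin n) (hi : (i : ℕ) + 1 < n), A i j ≤ A ⟨i + 1, hi⟩ j) ∧
       (∀ i j : Fin n, A i j < m)}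

/-- `y = min {x | A[r][x] ≥ h}`, where `y = n` if there is no such `x`. -/
def IsFirstGE {n : ℕ} (A : Fin n → Fin n → ℕ) (r : Fin n) (h y : ℕ) : Prop :=
  ((∃ x : Fin n, h ≤ A r x) → IsLeast {x : ℕ | ∃ hx : x < n, h ≤ A r ⟨x, hx⟩} y) ∧
  ((¬ ∃ x : Fin n, h ≤ A r x) → y = n)

/-- The array padded by `-1` at negative indices and by `m` at indices that are too large. -/
def padded {n : ℕ} (m : ℕ) (A : Fin n → Fin n → ℕ) (i j : ℤ) : ℤ :=
  if i < 0 ∨ j < 0 then -1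
  else if h : i.toNat < n ∧ j.toNat < n then (A ⟨i.toNat, h.1⟩ ⟨j.toNat, h.2⟩ : ℤ)
  else (m : ℤ)

/-- An edge of the grid graph on `{0, …, n}²`, as the pair of its end points, the one with the
smaller coordinates first. -/
abbrev GridEdge : Type := (ℤ × ℤ) × (ℤ × ℤ)

/-- The `k`-th boundary of the array: the set of those edges of the `(n+1) × (n+1)` grid graph
that separate the entries `< k` from the entries `≥ k`. -/
def boundary {n : ℕ} (m : ℕ) (A : Fin n → Fin n → ℕ) (k : ℕ) : Set GridEdge :=
  {e | ∃ i j : ℤ, (0 ≤ i ∧ i < n) ∧ (0 ≤ j ∧ j ≤ n) ∧ e = ((i, j), (i + 1, j)) ∧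
        padded m A i (j - 1) < k ∧ (k : ℤ) ≤ padded m A i j} ∪
  {e | ∃ i j : ℤ, (0 ≤ i ∧ i ≤ n) ∧ (0 ≤ j ∧ j < n) ∧ e = ((i, j), (i, j + 1)) ∧
        padded m A (i - 1) j < k ∧ (k : ℤ) ≤ padded m A i j}

/-- The edges traversed from the vertex `(i, j)` when the bits are read in order: `true` (bit 1)
is a step to the right, `(i, j) → (i + 1, j)`; `false` (bit 0) is a step down,
`(i, j) → (i, j - 1)`. -/
def pathEdges : ℤ → ℤ → List Bool → List GridEdge
  | _, _, [] => []
  | i, j, true :: b => ((i, j), (i + 1, j)) :: pathEdges (i + 1) j b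
  | i, j, false :: b => ((i, j - 1), (i, j)) :: pathEdges i (j - 1) b

/-- `b` is the `2n`-bit vector that describes the traversal of the `k`-th boundary of `A`,
starting at the vertex `(0, n)`. -/
def IsBoundaryCode {n : ℕ} (m : ℕ) (A : Fin n → Fin n → ℕ) (k : ℕ) (b : List Bool) : Prop :=
  b.length = 2 * n ∧ {e : GridEdge | e ∈ pathEdges 0 n b} = boundary m A k

/-- `bitRank c b p`: the number of bits equal to `c` among the first `p` bits of `b`. -/
def bitRank (c : Bool) (b : List Bool) (p : ℕ) : ℕ := (b.take p).count c

/-- `bitSelect c b i`: the least `p` such that the first `p` bits contain `i` bits equal to `c`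
(so, for `1 ≤ i`, the position of the `i`-th such bit, positions counted from 1). -/
noncomputable def bitSelect (c : Bool) (b : List Bool) (i : ℕ) : ℕ :=
  sInf {p : ℕ | bitRank c b p = i}

/-! ### A word RAM with `w`-bit words that queries a read-only bit string -/

namespace WordRAM

/-- The binary operations on words. -/
inductive Op : Type
  | add | sub | mul | div | mod | and | or | xor | shl | shr | lt

/-- The value of a binary operation on `w`-bit words (natural numbers below `2 ^ w`); arithmetic
is modulo `2 ^ w`, `lt` is `1` or `0`. -/
def Op.eval (w : ℕ) : Op → ℕ → ℕ → ℕ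
  | .add, a, b => (a + b) % 2 ^ w
  | .sub, a, b => (a + (2 ^ w - b)) % 2 ^ w
  | .mul, a, b => (a * b) % 2 ^ w
  | .div, a, b => a / b
  | .mod, a, b => a % b
  | .and, a, b => a &&& b
  | .or, a, b => a ||| b
  | .xor, a, b => a ^^^ b
  | .shl, a, b => (a * 2 ^ b) % 2 ^ w
  | .shr, a, b => a / 2 ^ b
  | .lt, a, b => if a < b then 1 else 0

/-- The instructions; `d`, `a`, `b` are numbers of registers and `t` is a line of the program. -/
inductive Instr : Type
  /-- put the constant `v` into register `d` -/
  | const (d v : ℕ)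
  /-- copy register `a` into register `d` -/
  | move (d a : ℕ)
  /-- apply a binary operation to the registers `a` and `b`, result in register `d` -/
  | bin (o : Op) (d a b : ℕ)
  /-- read the memory word whose address is in register `a` into register `d` -/
  | load (d a : ℕ)
  /-- jump to line `t` -/
  | jump (t : ℕ)
  /-- jump to line `t` if register `a` is zero -/
  | jumpZero (a t : ℕ)
  /-- stop; the output is the content of register `0` -/
  | halt

/-- A program is a finite list of instructions; execution starts at line `0`. -/
abbrev Program : Type := List Instr

/-- The line to be executed next and the contents of the registers. -/
structure State where
  pc : ℕ
  reg : ℕ → ℕ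

/-- The state that assigns `v` to register `d` and goes on to the next line. -/
def State.set (s : State) (d v : ℕ) : State :=
  ⟨s.pc + 1, Function.update s.reg d v⟩

/-- The bit string `D` laid out in memory: the word at address `a` consists of the bits
`a * w, …, a * w + w - 1` of `D`, least significant bit first, with zeros after the end of `D`. -/
def memWord (w : ℕ) (D : List Bool) (a : ℕ) : ℕ :=
  ∑ i ∈ Finset.range w, if D.getD (a * w + i) false then 2 ^ i else 0

/-- The effect of one instruction (`halt` is treated in `run`). -/
def exec (w : ℕ) (D : List Bool) : Instr → State → State
  | .const d v, s => s.set d (v % 2 ^ w)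
  | .move d a, s => s.set d (s.reg a)
  | .bin o d a b, s => s.set d (o.eval w (s.reg a) (s.reg b))
  | .load d a, s => s.set d (memWord w D (s.reg a))
  | .jump t, s => ⟨t, s.reg⟩
  | .jumpZero a t, s => ⟨if s.reg a = 0 then t else s.pc + 1, s.reg⟩
  | .halt, s => s

/-- `run w D P T s = some y`: started in state `s`, the program `P` stops with output `y` after
executing at most `T` instructions. -/
def run (w : ℕ) (D : List Bool) (P : Program) : ℕ → State → Option ℕ
  | 0, _ => none
  | T + 1, s =>
    match P[s.pc]? with
    | none => none
    | some .halt => some (s.reg 0)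
    | some ins => run w D P T (exec w D ins s)

/-- The initial state: the registers `0, 1, 2, …` hold the listed inputs, all others `0`. -/
def initial (inputs : List ℕ) : State := ⟨0, fun i => inputs.getD i 0⟩

end WordRAM

/-! Let N = nm and let G(i) be the number of zeros before the i-th one (counted from 0) in the
concatenation of the boundary codes. G is monotone and bounded by N, and if y answers the query (r,
h) with h < m, then G(hn + r) = hn + (n - y). A query is thus one access to G, and it suffices to
support access in constant time with O(N) bits (`eval_access`).

This is a two-level select structure. Let L be the binary length of N and l that of L. Every (lL)-th
value of G is sampled with L bits. If a block of lL elements has span at least lL · L, all its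
elements are stored explicitly: the span pays for the bits, so blocks written from position G(first
element) on cannot collide (`sparseBits_apply`). Otherwise the span is below lL² ≤ 2^(3l), values
relative to the sample need only 3l bits, and the scheme is repeated with blocks of l elements. The
elements of a block that is dense again lie in a window of l + 3l² bits of the unary code of G. A
table over all such windows finds them; it has 2^O((log log N)²) = O(N) bits (`exists_table_bound`).

The program evaluates a fixed expression by straight-line code, so its running time is its length
(`run_compile`). Having no logarithm instruction, it decodes l and L from a header by a carry trick
(`xor_succ_of_trailing_ones`). The boundary codes are appended to the structure; that they trace the
boundaries and yield the rank/select formula is an argument about lattice paths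
(`isBoundaryCode_boundaryCode`, `firstGE_add_bitRank`). -/

namespace WordRAM

/-! ### Expressions over the five inputs and their compilation to straight-line programs -/

/-- Expressions over the inputs, the word operations and memory accesses. -/
inductive Expr : Type
  | var (i : Fin 5)
  | const (v : ℕ)
  | bin (o : Op) (a b : Expr)
  | load (a : Expr)

namespace Expr

/-- The value of an expression. -/
def eval (w : ℕ) (D : List Bool) (env : Fin 5 → ℕ) : Expr → ℕ
  | var i => env i
  | const v => v % 2 ^ w
  | bin o a b => o.eval w (a.eval w D env) (b.eval w D env)
  | load a => memWord w D (a.eval w D env)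

/-- Straight-line code that puts the value of the expression into register `d` and otherwise
changes only registers above `d`. -/
def compile : Expr → ℕ → Program
  | var i, d => [.move d i]
  | const v, d => [.const d v]
  | bin o a b, d => a.compile d ++ b.compile (d + 1) ++ [.bin o d d (d + 1)]
  | load a, d => a.compile d ++ [.load d d]

end Expr

lemma run_append_singleton {w : ℕ} {D : List Bool} {pre post : Program} {ins : Instr}
    (hins : ins ≠ .halt) {s : State} (hs : s.pc = pre.length) (T : ℕ) :
    run w D (pre ++ ([ins] ++ post)) (T + 1) s =
      run w D (pre ++ ([ins] ++ post)) T (exec w D ins s) := by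
  have h : (pre ++ ([ins] ++ post))[s.pc]? = some ins := by simp [hs]
  rw [run, h]
  cases ins <;> simp_all

/-- Quantifying over the surrounding code `pre`, `post` lets the induction pass to subexpressions.
Preservation of the registers below `d` protects the inputs (whence 5 ≤ d) and keeps the left
operand alive while the right one is computed. -/
lemma run_compile (w : ℕ) (D : List Bool) (env : Fin 5 → ℕ) (e : Expr) :
    ∀ (d : ℕ), 5 ≤ d → ∀ (pre post : Program) (s : State), s.pc = pre.length →
      (∀ i : Fin 5, s.reg i = env i) →
      ∃ s' : State, s'.pc = (pre ++ e.compile d).length ∧ s'.reg d = e.eval w D env ∧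
        (∀ j < d, s'.reg j = s.reg j) ∧
        ∀ T, run w D (pre ++ (e.compile d ++ post)) (T + (e.compile d).length) s =
          run w D (pre ++ (e.compile d ++ post)) T s' := by
  induction e with
  | var i =>
    intro d hd pre post s hs henv
    refine ⟨exec w D (.move d i) s, by simp [exec, State.set, Expr.compile, hs],
      by simp [exec, State.set, Expr.eval, henv], fun j hj => ?_, fun T => ?_⟩
    · simp [exec, State.set, Function.update_of_ne hj.ne]
    · exact run_append_singleton (by simp) hs T
  | const v =>
    intro d hd pre post s hs henv
    refine ⟨exec w D (.const d v) s, by simp [exec, State.set, Expr.compile, hs],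
      by simp [exec, State.set, Expr.eval], fun j hj => ?_, fun T => ?_⟩
    · simp [exec, State.set, Function.update_of_ne hj.ne]
    · exact run_append_singleton (by simp) hs T
  | bin o a b iha ihb =>
    intro d hd pre post s hs henv
    obtain ⟨s₁, hpc₁, hv₁, hr₁, hrun₁⟩ := iha d hd pre
      (b.compile (d + 1) ++ ([.bin o d d (d + 1)] ++ post)) s hs henv
    obtain ⟨s₂, hpc₂, hv₂, hr₂, hrun₂⟩ := ihb (d + 1) (by omega) (pre ++ a.compile d)
      ([.bin o d d (d + 1)] ++ post) s₁ hpc₁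
      (fun i => by rw [hr₁ _ (by omega), henv])
    refine ⟨exec w D (.bin o d d (d + 1)) s₂, ?_, ?_, fun j hj => ?_, fun T => ?_⟩
    · simp [exec, State.set, Expr.compile, hpc₂, add_assoc]
    · simp [exec, State.set, Expr.eval, hv₂, hr₂, hv₁]
    · simp [exec, State.set, Function.update_of_ne hj.ne, hr₂ j (by omega), hr₁ j hj]
    · have h₃ := run_append_singleton (w := w) (D := D) (ins := .bin o d d (d + 1)) (by simp)
        (pre := pre ++ a.compile d ++ b.compile (d + 1)) (post := post) hpc₂ T
      have e₁ := hrun₁ (T + 1 + (b.compile (d + 1)).length)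
      have e₂ := hrun₂ (T + 1)
      simp only [Expr.compile, List.append_assoc, List.length_append, List.length_singleton]
        at h₃ e₁ e₂ ⊢
      rw [← h₃, ← e₂, ← e₁]
      congr 1
      omega
  | load a iha =>
    intro d hd pre post s hs henv
    obtain ⟨s₁, hpc₁, hv₁, hr₁, hrun₁⟩ := iha d hd pre ([.load d d] ++ post) s hs henv
    refine ⟨exec w D (.load d d) s₁, ?_, ?_, fun j hj => ?_, fun T => ?_⟩
    · simp [exec, State.set, Expr.compile, hpc₁, add_assoc]
    · simp [exec, State.set, Expr.eval, hv₁]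
    · simp [exec, State.set, Function.update_of_ne hj.ne, hr₁ j hj]
    · have h₃ := run_append_singleton (w := w) (D := D) (ins := .load d d) (by simp)
        (pre := pre ++ a.compile d) (post := post) hpc₁ T
      have e₁ := hrun₁ (T + 1)
      simp only [Expr.compile, List.append_assoc, List.length_append, List.length_singleton]
        at h₃ e₁ ⊢
      rw [← h₃, ← e₁]
      congr 1
      omega

/-- The program that outputs the value of an expression. -/
def Expr.program (e : Expr) : Program := e.compile 5 ++ [.move 0 5, .halt]

lemma Expr.run_program (w : ℕ) (D : List Bool) (e : Expr) (inputs : List ℕ) :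
    run w D e.program ((e.compile 5).length + 2) (initial inputs) =
      some (e.eval w D fun i => inputs.getD i 0) := by
  obtain ⟨s, hpc, hv, -, hrun⟩ := run_compile w D (fun i => inputs.getD i 0) e 5 le_rfl []
    [.move 0 5, .halt] (initial inputs) rfl (fun _ => rfl)
  have h := hrun 2
  simp only [List.nil_append] at h hpc
  rw [Expr.program, add_comm, h]
  simp [run, hpc, exec, State.set, hv]

end WordRAM

/-! ### Bit strings as numbers -/

/-- The number whose binary digits are the given bits, least significant bit first. -/
def bitsToNat : List Bool → ℕ
  | [] => 0
  | b :: l => Nat.bit b (bitsToNat l)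

lemma testBit_bitsToNat (l : List Bool) (j : ℕ) : (bitsToNat l).testBit j = l.getD j false := by
  induction l generalizing j with
  | nil => simp [bitsToNat]
  | cons b l ih =>
    cases j with
    | zero => simp [bitsToNat]
    | succ j => simp [bitsToNat, Nat.testBit_bit_succ, ih]

lemma sum_bits_eq_mod (l : List Bool) (p k : ℕ) :
    (∑ i ∈ Finset.range k, if l.getD (p + i) false then 2 ^ i else 0) =
      bitsToNat l / 2 ^ p % 2 ^ k := by
  induction k with
  | zero => simp [Nat.mod_one]
  | succ k ih =>
    rw [Finset.sum_range_succ, ih, pow_succ, Nat.mod_mul, ← Nat.toNat_testBit,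
      Nat.testBit_div_two_pow, testBit_bitsToNat, add_comm k p]
    cases l.getD (p + k) false <;> simp

/-- The number stored in the `k` bits of `D` from position `p` on. -/
def bitField (D : List Bool) (p k : ℕ) : ℕ := bitsToNat D / 2 ^ p % 2 ^ k

lemma WordRAM.memWord_eq (w : ℕ) (D : List Bool) (a : ℕ) :
    memWord w D a = bitField D (a * w) w := sum_bits_eq_mod D (a * w) w

lemma bitField_lt (D : List Bool) (p k : ℕ) : bitField D p k < 2 ^ k :=
  Nat.mod_lt _ (by positivity)

lemma testBit_bitField (D : List Bool) (p k j : ℕ) :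
    (bitField D p k).testBit j = (decide (j < k) && D.getD (p + j) false) := by
  rw [bitField, Nat.testBit_mod_two_pow, Nat.testBit_div_two_pow, testBit_bitsToNat, add_comm]

lemma bitField_eq_of_getD {D : List Bool} {p k v : ℕ} (hv : v < 2 ^ k)
    (h : ∀ j < k, D.getD (p + j) false = v.testBit j) : bitField D p k = v := by
  refine Nat.eq_of_testBit_eq fun j => ?_
  rw [testBit_bitField]
  by_cases hj : j < k
  · rw [← h j hj]; simp [hj]
  · rw [Nat.testBit_lt_two_pow (hv.trans_le (Nat.pow_le_pow_right (by norm_num) (not_lt.1 hj)))]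
    simp [hj]

/-- A field that straddles two words, assembled from them. -/
lemma bitField_of_words {w k : ℕ} (hw : 0 < w) (hk : k ≤ w) (D : List Bool) (p : ℕ) :
    (bitField D (p / w * w) w / 2 ^ (p % w) +
      bitField D ((p / w + 1) * w) w * 2 ^ (w - p % w) % 2 ^ w) % 2 ^ k = bitField D p k := by
  have ho : p % w < w := Nat.mod_lt _ hw
  obtain ⟨e, he⟩ : ∃ e, w = e + p % w := ⟨w - p % w, by omega⟩
  set o := p % w
  have hp : p = p / w * w + o := by rw [mul_comm]; exact (Nat.div_add_mod p w).symm
  set Y := bitsToNat D / 2 ^ (p / w * w) with hY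
  have h1 : bitField D p w = Y / 2 ^ o % 2 ^ w := by
    rw [bitField, hY, Nat.div_div_eq_div_mul, ← pow_add, ← hp]
  have h2 : bitField D ((p / w + 1) * w) w = Y / 2 ^ w % 2 ^ w := by
    rw [bitField, hY, Nat.div_div_eq_div_mul, ← pow_add, add_mul, one_mul]
  have h3 : bitField D (p / w * w) w = Y % 2 ^ w := rfl
  -- For offset 0 the second word is shifted by all w bits and vanishes modulo 2^w, so aligned
  -- fields need no case distinction.
  have key : Y % 2 ^ w / 2 ^ o + Y / 2 ^ w % 2 ^ w * 2 ^ (w - o) % 2 ^ w = Y / 2 ^ o % 2 ^ w := by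
    have hsub : w - o = e := by omega
    have hpow : 2 ^ w = 2 ^ e * 2 ^ o := by rw [← pow_add, ← he]
    have hpow' : 2 ^ w = 2 ^ o * 2 ^ e := by rw [hpow, mul_comm]
    have a1 : Y % 2 ^ w / 2 ^ o = Y / 2 ^ o % 2 ^ e := by
      rw [hpow', Nat.mod_mul_right_div_self]
    have a2 : Y / 2 ^ w % 2 ^ w * 2 ^ e % 2 ^ w = 2 ^ e * (Y / 2 ^ w % 2 ^ o) := by
      conv_lhs => rw [mul_comm]
      conv_lhs => rhs; rw [hpow]
      rw [Nat.mul_mod_mul_left, Nat.mod_mod_of_dvd]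
      rw [hpow]; exact Dvd.intro_left _ rfl
    have a3 : Y / 2 ^ o % 2 ^ w = Y / 2 ^ o % 2 ^ e + 2 ^ e * (Y / 2 ^ w % 2 ^ o) := by
      conv_lhs => rhs; rw [hpow]
      rw [Nat.mod_mul, Nat.div_div_eq_div_mul Y, ← hpow']
    rw [hsub, a1, a2, a3]
  rw [h2, h3, key, ← h1, bitField, bitField]
  exact Nat.mod_mod_of_dvd _ (pow_dvd_pow 2 hk)

/-! ### Word expressions that compute without overflow. -/

namespace WordRAM.Expr

instance : Add Expr := ⟨bin .add⟩
instance : Sub Expr := ⟨bin .sub⟩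
instance : Mul Expr := ⟨bin .mul⟩
instance : Div Expr := ⟨bin .div⟩
instance : Mod Expr := ⟨bin .mod⟩

section Eval

variable {w : ℕ} {D : List Bool} {env : Fin 5 → ℕ} {a b e : Expr} {x y z : ℕ}

/-- Bounds expressions whose value is otherwise unknown, such as the discarded branch of an `ite`,
which is evaluated all the same and may read arbitrary memory. -/
lemma eval_lt (hw : 0 < w) (henv : ∀ i, env i < 2 ^ w) (e : Expr) : e.eval w D env < 2 ^ w := by
  have hpos : 0 < 2 ^ w := by positivity
  induction e with
  | var i => exact henv i
  | const v => exact Nat.mod_lt _ hpos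
  | load a => rw [eval, memWord_eq]; exact bitField_lt _ _ _
  | bin o a b iha ihb =>
    cases o with
    | add => exact Nat.mod_lt _ hpos
    | sub => exact Nat.mod_lt _ hpos
    | mul => exact Nat.mod_lt _ hpos
    | shl => exact Nat.mod_lt _ hpos
    | div => exact (Nat.div_le_self _ _).trans_lt iha
    | shr => exact (Nat.div_le_self _ _).trans_lt iha
    | mod => exact (Nat.mod_le _ _).trans_lt iha
    | and => exact Nat.and_lt_two_pow _ ihb
    | or => exact Nat.or_lt_two_pow iha ihb
    | xor => exact Nat.xor_lt_two_pow iha ihb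
    | lt =>
      simp only [eval, Op.eval]
      split_ifs
      · exact Nat.one_lt_two_pow hw.ne'
      · exact hpos

lemma eval_const {v : ℕ} (hv : v < 2 ^ w) : (const v).eval w D env = v := Nat.mod_eq_of_lt hv

lemma eval_add (ha : a.eval w D env = x) (hb : b.eval w D env = y) (h : x + y < 2 ^ w) :
    (a + b).eval w D env = x + y := by
  subst ha hb; exact Nat.mod_eq_of_lt h

lemma eval_mul (ha : a.eval w D env = x) (hb : b.eval w D env = y) (h : x * y < 2 ^ w) :
    (a * b).eval w D env = x * y := by
  subst ha hb; exact Nat.mod_eq_of_lt h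

lemma eval_sub (ha : a.eval w D env = x) (hb : b.eval w D env = y) (hx : x < 2 ^ w)
    (h : y ≤ x) : (a - b).eval w D env = x - y := by
  subst ha hb
  change (_ + (2 ^ w - _)) % 2 ^ w = _
  rw [← Nat.add_sub_assoc (h.trans hx.le), Nat.sub_add_comm h, Nat.add_mod_right]
  exact Nat.mod_eq_of_lt ((Nat.sub_le _ _).trans_lt hx)

lemma eval_div (ha : a.eval w D env = x) (hb : b.eval w D env = y) :
    (a / b).eval w D env = x / y := by
  subst ha hb; rfl

lemma eval_mod (ha : a.eval w D env = x) (hb : b.eval w D env = y) :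
    (a % b).eval w D env = x % y := by
  subst ha hb; rfl

/-- `ite a b e` is `b` if the flag `a` is `1` and `e` if it is `0`. -/
def ite (a b e : Expr) : Expr := a * b + (const 1 - a) * e

lemma eval_ite (hw : 0 < w) (henv : ∀ i, env i < 2 ^ w) {p : Prop} [Decidable p]
    (ha : a.eval w D env = if p then 1 else 0) :
    (ite a b e).eval w D env = if p then b.eval w D env else e.eval w D env := by
  have hb := eval_lt (D := D) hw henv b
  have he := eval_lt (D := D) hw henv e
  have h1 : 1 < 2 ^ w := Nat.one_lt_two_pow hw.ne'
  have hsub := eval_sub (eval_const h1) ha h1 (by split_ifs <;> simp)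
  rw [ite]
  split_ifs with hp <;> simp only [hp, if_true, if_false] at ha hsub
  · rw [eval_add (eval_mul ha rfl (by simpa)) (eval_mul hsub rfl (by simp)) (by simpa)]
    simp
  · rw [eval_add (eval_mul ha rfl (by simp)) (eval_mul hsub rfl (by simpa)) (by simpa)]
    simp

/-- The number stored in the given number of bits from the given bit position on. -/
def read (pos len : Expr) : Expr :=
  (bin .shr (load (pos / var 4)) (pos % var 4) +
    bin .shl (load (pos / var 4 + const 1)) (var 4 - pos % var 4)) % bin .shl (const 1) len

/-- The strict bound y < w makes the modulus 2^y representable in a word; x + 1 < 2^w keeps the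
address of the following word from wrapping around. -/
lemma eval_read (hw : 0 < w) (henv : env 4 = w) (ha : a.eval w D env = x)
    (hb : b.eval w D env = y) (hx : x + 1 < 2 ^ w) (hy : y < w) :
    (read a b).eval w D env = bitField D x y := by
  have h1 : 1 < 2 ^ w := Nat.one_lt_two_pow hw.ne'
  have hv : (var 4).eval w D env = w := henv
  have hq := eval_div ha hv
  have hr := eval_mod ha hv
  have hq1 := eval_add hq (eval_const h1)
    ((Nat.add_le_add_right (Nat.div_le_self _ _) 1).trans_lt hx)
  have hs := eval_sub hv hr w.lt_two_pow_self (Nat.mod_lt _ hw).le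
  have hlen : (bin .shl (const 1) b).eval w D env = 2 ^ y := by
    change (const 1).eval w D env * 2 ^ b.eval w D env % 2 ^ w = _
    rw [eval_const h1, hb, one_mul, Nat.mod_eq_of_lt (Nat.pow_lt_pow_right (by norm_num) hy)]
  have hlo : (bin .shr (load (a / var 4)) (a % var 4)).eval w D env =
      bitField D (x / w * w) w / 2 ^ (x % w) := by
    change memWord w D ((a / var 4).eval w D env) / 2 ^ (a % var 4).eval w D env = _
    rw [hq, hr, memWord_eq]
  have hhi : (bin .shl (load (a / var 4 + const 1)) (var 4 - a % var 4)).eval w D env =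
      bitField D ((x / w + 1) * w) w * 2 ^ (w - x % w) % 2 ^ w := by
    change memWord w D ((a / var 4 + const 1).eval w D env) *
      2 ^ (var 4 - a % var 4).eval w D env % 2 ^ w = _
    rw [hq1, hs, memWord_eq]
  have h := bitField_of_words hw hy.le D x
  rw [← hlo, ← hhi] at h
  rw [← h, read]
  change ((_ : ℕ) + _) % 2 ^ w % _ = _
  rw [hlen]
  exact Nat.mod_mod_of_dvd _ (pow_dvd_pow 2 hy.le)

end Eval

end WordRAM.Expr

/-! ### The segments of the data structure for a monotone sequence -/

/-- An array of entries of `u` bits. -/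
def fieldBits (u : ℕ) (f : ℕ → ℕ) (p : ℕ) : Bool := (f (p / u)).testBit (p % u)

/-- The `k`-th block of `s` elements of `G` has a span of at least `s * u`. -/
def IsSparse (G : ℕ → ℕ) (s u k : ℕ) : Prop := s * u ≤ G ((k + 1) * s) - G (k * s)

open Classical in
/-- The entries of the sparse blocks, in `u` bits each and relative to `base`; those of the `k`-th
block begin at position `G (k * s)`, so that different blocks do not overlap. -/
noncomputable def sparseBits (G base : ℕ → ℕ) (s u p : ℕ) : Bool :=
  decide (∃ i j, IsSparse G s u (i / s) ∧ j < u ∧ p = G (i / s * s) + u * (i % s) + j ∧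
    (G i - base (i / s)).testBit j = true)

/-- The unary code of `G`: the `i`-th one is at position `G i + i`. -/
noncomputable def unaryBits (G : ℕ → ℕ) (p : ℕ) : Bool :=
  open Classical in decide (∃ i, G i + i = p)

/-- The bit strings `seg 0, …, seg (c - 1)`, of `q` bits each, one after the other. -/
def concatSegments (c q : ℕ) (seg : ℕ → ℕ → Bool) : List Bool :=
  (List.range (c * q)).map fun p => seg (p / q) (p % q)

lemma getD_concatSegments {c q a p : ℕ} (seg : ℕ → ℕ → Bool) (rest : List Bool) (ha : a < c)
    (hp : p < q) : (concatSegments c q seg ++ rest).getD (a * q + p) false = seg a p := by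
  have hlt : a * q + p < c * q := by nlinarith
  have hdiv : (a * q + p) / q = a := by
    rw [mul_comm, Nat.mul_add_div (by omega), Nat.div_eq_of_lt hp, add_zero]
  have hmod : (a * q + p) % q = p := by
    rw [mul_comm, Nat.mul_add_mod, Nat.mod_eq_of_lt hp]
  simp [concatSegments, List.getElem?_append_left, hlt, hdiv, hmod]

lemma bitField_fieldBits {D : List Bool} {a q u k : ℕ} {f : ℕ → ℕ}
    (hD : ∀ p < q, D.getD (a * q + p) false = fieldBits u f p) (hu : u * (k + 1) ≤ q) :
    bitField D (a * q + u * k) u = f k % 2 ^ u := by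
  refine bitField_eq_of_getD (Nat.mod_lt _ (by positivity)) fun j hj => ?_
  have hlt : u * k + j < q := by rw [mul_add] at hu; omega
  rw [add_assoc, hD _ hlt, fieldBits, Nat.mul_add_div (by omega), Nat.div_eq_of_lt hj, add_zero,
    Nat.mul_add_mod, Nat.mod_eq_of_lt hj, Nat.testBit_mod_two_pow]
  simp [hj]

/-- The s entries of u bits of a sparse block fit between G(ks) and G((k+1)s). A position therefore
determines its block, then the entry by division by u, then the bit. -/
lemma sparseBits_apply {G base : ℕ → ℕ} (hG : Monotone G) {s u i j : ℕ} (hs : 0 < s)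
    (hi : IsSparse G s u (i / s)) (hj : j < u) :
    sparseBits G base s u (G (i / s * s) + u * (i % s) + j) =
      (G i - base (i / s)).testBit j := by
  have hu : 0 < u := by omega
  have bound : ∀ {i j : ℕ}, IsSparse G s u (i / s) → j < u →
      G (i / s * s) + u * (i % s) + j < G ((i / s + 1) * s) := by
    intro i j hi hj
    have hm : i % s < s := Nat.mod_lt _ hs
    have h1 : u * (i % s + 1) ≤ s * u := by rw [mul_comm]; exact Nat.mul_le_mul_right _ hm
    have h2 : 0 < s * u := Nat.mul_pos hs hu
    unfold IsSparse at hi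
    rw [mul_add] at h1
    omega
  have sep : ∀ {i j i' j' : ℕ}, IsSparse G s u (i / s) → j < u → i / s < i' / s →
      G (i / s * s) + u * (i % s) + j < G (i' / s * s) + u * (i' % s) + j' := by
    intro i j i' j' hi hj h
    have h1 := bound hi hj
    have h2 : G ((i / s + 1) * s) ≤ G (i' / s * s) := hG (Nat.mul_le_mul_right _ h)
    omega
  classical
  rw [Bool.eq_iff_iff, sparseBits, decide_eq_true_iff]
  constructor
  · rintro ⟨i', j', hi', hj', hp, hb⟩
    have hq : i / s = i' / s := by
      rcases lt_trichotomy (i / s) (i' / s) with h | h | h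
      · exact absurd hp (sep hi hj h).ne
      · exact h
      · exact absurd hp (sep hi' hj' h).ne'
    rw [← hq] at hp
    have hp' : u * (i % s) + j = u * (i' % s) + j' := by omega
    have hdiv := congrArg (· / u) hp'
    simp only [Nat.mul_add_div hu, Nat.div_eq_of_lt hj, Nat.div_eq_of_lt hj', add_zero] at hdiv
    have hii : i = i' := by rw [← Nat.div_add_mod i s, ← Nat.div_add_mod i' s, hq, hdiv]
    subst hii
    have hjj : j = j' := by omega
    rwa [hjj]
  · exact fun h => ⟨i, j, hi, hj, rfl, h⟩

/-- The ones in front of position j of a window starting at e k are those of the indices in [k, i),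
so there are i - k of them, and `Nat.nth` counts from 0. -/
lemma nth_window {e : ℕ → ℕ} (he : StrictMono e) {p : ℕ → Prop} {t i k j : ℕ}
    (hp : ∀ j < t, p j ↔ ∃ i', e i' = e k + j) (hj : e i = e k + j) (hjt : j < t) :
    Nat.nth p (i - k) = j := by
  classical
  have hcount : Nat.count p j = i - k := by
    have himg : (Finset.range j).filter p = (Finset.Ico k i).image fun i' => e i' - e k := by
      ext j'
      simp only [Finset.mem_filter, Finset.mem_range, Finset.mem_image, Finset.mem_Ico]
      constructor
      · rintro ⟨h1, h2⟩
        obtain ⟨i', hi'⟩ := (hp j' (h1.trans hjt)).1 h2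
        exact ⟨i', ⟨he.le_iff_le.1 (by omega), he.lt_iff_lt.1 (by omega)⟩, by omega⟩
      · rintro ⟨i', ⟨h1, h2⟩, rfl⟩
        have h3 := he.monotone h1
        have h4 := he h2
        exact ⟨by omega, (hp _ (by omega)).2 ⟨i', by omega⟩⟩
    rw [Nat.count_eq_card_filter_range, himg, Finset.card_image_of_injOn, Nat.card_Ico]
    intro x hx y hy hxy
    simp only [Finset.coe_Ico, Set.mem_Ico] at hx hy
    have h1 := he.monotone hx.1
    have h2 := he.monotone hy.1
    exact he.injective (by simp only at hxy; omega)
  rw [← hcount]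
  exact Nat.nth_count ((hp j hjt).2 ⟨i, hj⟩)

namespace WordRAM.Expr

/-! ### One level of sampling -/

/-- The first element of the block that contains element `i`. -/
def sample (seg : ℕ) (q s u base i : Expr) : Expr := base + read (const seg * q + u * (i / s)) u

/-- Whether the block that contains element `i` is sparse. -/
def sparseFlag (seg : ℕ) (q s i : Expr) : Expr := read (const (seg + 1) * q + i / s) (const 1)

/-- The element `i` of a sparse block. -/
def sparseEntry (seg : ℕ) (q s u base i : Expr) : Expr :=
  base + read (const (seg + 2) * q + (sample seg q s u base i + u * (i % s))) u

section Level

variable {w : ℕ} {D : List Bool} {env : Fin 5 → ℕ} {q s u base i : Expr}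
  {Q vs vu vi seg : ℕ} {G b : ℕ → ℕ}

/-- Positions in the nine segments are at most 9Q, so the slack in 20Q < 2^w absorbs every
intermediate sum. -/
lemma eval_segment_pos {a p : ℕ} {e : Expr} (hQw : 20 * Q < 2 ^ w) (hQ : 20 ≤ Q)
    (hq : q.eval w D env = Q) (ha : a < 9) (he : e.eval w D env = p) (hp : p ≤ Q) :
    (const a * q + e).eval w D env = a * Q + p ∧ a * Q + p + 1 < 2 ^ w := by
  have h1 : a * Q ≤ 8 * Q := Nat.mul_le_mul_right _ (by omega)
  exact ⟨eval_add (eval_mul (eval_const (by omega)) hq (by omega)) he (by omega), by omega⟩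

lemma eval_sample (hw : 0 < w) (henv : env 4 = w) (hQw : 20 * Q < 2 ^ w) (hQ : 20 ≤ Q)
    (hq : q.eval w D env = Q) (hs : s.eval w D env = vs) (hu : u.eval w D env = vu)
    (hi : i.eval w D env = vi) (hbase : base.eval w D env = b (vi / vs)) (hseg : seg < 9)
    (hD : ∀ p < Q, D.getD (seg * Q + p) false = fieldBits vu (fun k => G (k * vs) - b k) p)
    (huw : vu < w) (huQ : vu * (vi / vs + 1) ≤ Q) (hb : b (vi / vs) ≤ G (vi / vs * vs))
    (hlt : G (vi / vs * vs) - b (vi / vs) < 2 ^ vu) (hGQ : G (vi / vs * vs) ≤ Q) :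
    (sample seg q s u base i).eval w D env = G (vi / vs * vs) := by
  have hle : vu * (vi / vs) ≤ Q := (Nat.mul_le_mul_left _ (Nat.le_succ _)).trans huQ
  obtain ⟨h1, h2⟩ := eval_segment_pos hQw hQ hq hseg
    (eval_mul hu (eval_div hi hs) (by omega)) hle
  have h3 := eval_read hw henv h1 hu h2 huw
  rw [bitField_fieldBits hD huQ, Nat.mod_eq_of_lt hlt] at h3
  rw [sample, eval_add hbase h3 (by omega)]
  omega

lemma eval_sparseFlag (hw : 1 < w) (henv : env 4 = w) (hQw : 20 * Q < 2 ^ w) (hQ : 20 ≤ Q)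
    (hq : q.eval w D env = Q) (hs : s.eval w D env = vs)
    (hi : i.eval w D env = vi) (hseg : seg + 1 < 9) (hiQ : vi < Q)
    {p : ℕ → Prop} [DecidablePred p]
    (hD : ∀ k < Q, D.getD ((seg + 1) * Q + k) false = decide (p k)) :
    (sparseFlag seg q s i).eval w D env = if p (vi / vs) then 1 else 0 := by
  have hlt : vi / vs < Q := (Nat.div_le_self _ _).trans_lt hiQ
  obtain ⟨h1, h2⟩ := eval_segment_pos hQw hQ hq hseg (eval_div hi hs) hlt.le
  have h3 := eval_read (b := const 1) hw.le henv h1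
    (eval_const (Nat.one_lt_two_pow (by omega))) h2 hw
  rw [sparseFlag, h3]
  refine bitField_eq_of_getD (by split_ifs <;> simp) fun j hj => ?_
  obtain rfl : j = 0 := by omega
  rw [add_zero, hD _ hlt]
  split_ifs with h <;> simp [h]

lemma eval_sparseEntry (hw : 0 < w) (henv : env 4 = w) (hQw : 20 * Q < 2 ^ w) (hQ : 20 ≤ Q)
    (hq : q.eval w D env = Q) (hs : s.eval w D env = vs) (hu : u.eval w D env = vu)
    (hi : i.eval w D env = vi) (hbase : base.eval w D env = b (vi / vs)) (hseg : seg + 2 < 9)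
    (hsample : (sample seg q s u base i).eval w D env = G (vi / vs * vs))
    (hD : ∀ p < Q, D.getD ((seg + 2) * Q + p) false = sparseBits G b vs vu p)
    (hG : Monotone G) (hvs : 0 < vs) (huw : vu < w) (hb : b (vi / vs) ≤ G vi)
    (hlt : G vi - b (vi / vs) < 2 ^ vu) (hGQ : ∀ k, G k ≤ Q)
    (hsparse : IsSparse G vs vu (vi / vs)) :
    (sparseEntry seg q s u base i).eval w D env = G vi := by
  have hm : vi % vs < vs := Nat.mod_lt _ hvs
  -- By sparsity the entry ends before the next block starts, hence inside the segment.
  have hend : G (vi / vs * vs) + (vu * (vi % vs) + vu) ≤ Q := by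
    have h1 : vu * (vi % vs + 1) ≤ vs * vu := by rw [mul_comm]; exact Nat.mul_le_mul_right _ hm
    have h2 := hGQ ((vi / vs + 1) * vs)
    have h3 : G (vi / vs * vs) ≤ G ((vi / vs + 1) * vs) :=
      hG (Nat.mul_le_mul_right _ (Nat.le_succ _))
    unfold IsSparse at hsparse
    rw [mul_add] at h1
    omega
  obtain ⟨h1, h2⟩ := eval_segment_pos hQw hQ hq hseg
    (eval_add hsample (eval_mul hu (eval_mod hi hs) (by omega)) (by omega))
    (show G (vi / vs * vs) + vu * (vi % vs) ≤ Q by omega)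
  have h3 := eval_read hw henv h1 hu h2 huw
  have h4 : bitField D ((seg + 2) * Q + (G (vi / vs * vs) + vu * (vi % vs))) vu =
      G vi - b (vi / vs) := by
    refine bitField_eq_of_getD hlt fun j hj => ?_
    rw [add_assoc, hD _ (by omega), sparseBits_apply hG hvs hsparse hj]
  rw [h4] at h3
  have := hGQ vi
  rw [sparseEntry, eval_add hbase h3 (by omega)]
  omega

end Level

end WordRAM.Expr

/-! ### The data structure for a monotone sequence -/

/-- The width of the windows of the lookup table. -/
def windowWidth (l : ℕ) : ℕ := l + l * (3 * l)

/-- The number stored in the header: `l` ones, a zero, `l` and `L` in `l` bits each. -/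
def headerWord (l L : ℕ) : ℕ := 2 ^ l - 1 + 2 ^ (l + 1) * (l + 2 ^ l * L)

open Classical in
/-- The segments: the header, the two levels of sampling, the unary code and the table of the
positions of the ones in short words. -/
noncomputable def monotoneSegments (G : ℕ → ℕ) (l L : ℕ) : ℕ → ℕ → Bool
  | 0 => (headerWord l L).testBit
  -- The subtracted 0 is the base of the first level; it gives both levels the form required by
  -- `eval_sample`.
  | 1 => fieldBits L fun k => G (k * (l * L)) - 0
  | 2 => fun k => decide (IsSparse G (l * L) L k)
  | 3 => sparseBits G (fun _ => 0) (l * L) L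
  | 4 => fieldBits (3 * l) fun k => G (k * l) - G (k / L * (l * L))
  | 5 => fun k => decide (IsSparse G l (3 * l) k)
  | 6 => sparseBits G (fun k => G (k / L * (l * L))) l (3 * l)
  | 7 => unaryBits G
  | _ => fieldBits (windowWidth l) fun idx =>
      Nat.nth (fun j => (idx / 2 ^ l).testBit j = true) (idx % 2 ^ l)

/-! ### Decoding the header and access through both levels. -/

namespace WordRAM.Expr

/-- The power of two coded by the ones at the beginning of the header. -/
def headerPow : Expr :=
  (bin .xor (load (const 0)) (load (const 0) + const 1) + const 1) / const 2

/-- The first number in the header. -/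
def headerFst : Expr := load (const 0) / (headerPow * const 2) % headerPow

/-- The second number in the header. -/
def headerSnd : Expr := load (const 0) / (headerPow * const 2) / headerPow % headerPow

section Header

variable {w : ℕ} {D : List Bool} {env : Fin 5 → ℕ} {l L : ℕ}

/-- The first word may continue beyond the header; z collects everything above the l ones and the
zero, and only its lowest 2l bits matter. The zero bit ensures that adding 1 to the word cannot
overflow, which is the use of the second conclusion. -/
lemma exists_load_header (hD : ∀ p < 3 * l + 1, D.getD p false = (headerWord l L).testBit p)
    (hl : l < 2 ^ l) (hL : L < 2 ^ l) (hw : 3 * l + 1 ≤ w) :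
    ∃ z, (load (const 0)).eval w D env = 2 ^ l - 1 + 2 ^ (l + 1) * z ∧
      2 ^ (l + 1) * (z + 1) ≤ 2 ^ w ∧ z % 2 ^ l = l ∧ z / 2 ^ l % 2 ^ l = L := by
  have hpos : 0 < 2 ^ l := by positivity
  have hsucc : 2 ^ (l + 1) = 2 ^ l + 2 ^ l := by ring
  have hload : (load (const 0)).eval w D env = bitField D 0 w := by
    change memWord w D (0 % 2 ^ w) = _
    rw [memWord_eq, Nat.zero_mod, zero_mul]
  have hin : l + 2 ^ l * L < 2 ^ l * 2 ^ l := by nlinarith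
  have hH : headerWord l L < 2 ^ (3 * l + 1) := by
    have : 2 ^ (3 * l + 1) = 2 ^ (l + 1) * (2 ^ l * 2 ^ l) := by ring
    rw [this, headerWord]
    have h1 : 2 ^ (l + 1) * (l + 2 ^ l * L + 1) ≤ 2 ^ (l + 1) * (2 ^ l * 2 ^ l) :=
      Nat.mul_le_mul_left _ hin
    rw [mul_add, mul_one] at h1
    omega
  have hf : bitField D 0 (3 * l + 1) = headerWord l L :=
    bitField_eq_of_getD hH fun j hj => by rw [zero_add, hD j hj]
  have hmod : bitField D 0 w % 2 ^ (3 * l + 1) = headerWord l L := by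
    rw [← hf, bitField, bitField, Nat.mod_mod_of_dvd _ (pow_dvd_pow 2 hw)]
  have hdecomp := Nat.div_add_mod (bitField D 0 w) (2 ^ (3 * l + 1))
  rw [hmod] at hdecomp
  set q := bitField D 0 w / 2 ^ (3 * l + 1)
  have hz : bitField D 0 w = 2 ^ l - 1 + 2 ^ (l + 1) * (l + 2 ^ l * (L + 2 ^ l * q)) := by
    rw [← hdecomp, headerWord]; ring
  refine ⟨l + 2 ^ l * (L + 2 ^ l * q), hload.trans hz, ?_, ?_, ?_⟩
  · have h1 := bitField_lt D 0 w
    rw [hz] at h1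
    obtain ⟨e, rfl⟩ : ∃ e, w = l + 1 + e := ⟨w - (l + 1), by omega⟩
    rw [pow_add 2 (l + 1) e] at h1 ⊢
    exact Nat.mul_le_mul_left _
      (Nat.lt_of_mul_lt_mul_left ((Nat.le_add_left _ _).trans_lt h1))
  · rw [Nat.add_mul_mod_self_left, Nat.mod_eq_of_lt hl]
  · rw [Nat.add_mul_div_left _ _ hpos, Nat.div_eq_of_lt hl, zero_add, Nat.add_mul_mod_self_left,
      Nat.mod_eq_of_lt hL]

/-- The carry runs through the l trailing ones and stops at the zero in bit l, so exactly the lowest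
l + 1 bits flip. -/
lemma xor_succ_of_trailing_ones (l z : ℕ) :
    (2 ^ l - 1 + 2 ^ (l + 1) * z) ^^^ (2 ^ l - 1 + 2 ^ (l + 1) * z + 1) = 2 ^ (l + 1) - 1 := by
  have hpos : 0 < 2 ^ l := by positivity
  have hsucc : 2 ^ (l + 1) = 2 ^ l + 2 ^ l := by ring
  have hx : 2 ^ l - 1 + 2 ^ (l + 1) * z = 2 ^ (l + 1) * z + (2 ^ l - 1) := add_comm _ _
  have hx' : 2 ^ (l + 1) * z + (2 ^ l - 1) + 1 = 2 ^ (l + 1) * z + 2 ^ l := by omega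
  refine Nat.eq_of_testBit_eq fun j => ?_
  rw [hx, hx', Nat.testBit_xor, Nat.testBit_two_pow_mul_add _ (by omega),
    Nat.testBit_two_pow_mul_add _ (by omega), Nat.testBit_two_pow_sub_one,
    Nat.testBit_two_pow_sub_one, Nat.testBit_two_pow]
  by_cases h : j < l + 1
  · rcases Nat.lt_succ_iff_lt_or_eq.1 h with h' | h'
    · simp [h, h', h'.ne']
    · simp [h']
  · simp [h]

lemma eval_header (hD : ∀ p < 3 * l + 1, D.getD p false = (headerWord l L).testBit p)
    (hL : L < 2 ^ l) (hl0 : 0 < l) (hw : 3 * l + 1 ≤ w) :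
    headerPow.eval w D env = 2 ^ l ∧ headerFst.eval w D env = l ∧
      headerSnd.eval w D env = L := by
  obtain ⟨z, hload, hz, hz1, hz2⟩ :=
    exists_load_header (env := env) hD l.lt_two_pow_self hL hw
  have hpos : 0 < 2 ^ l := by positivity
  have hsucc : 2 ^ (l + 1) = 2 ^ l + 2 ^ l := by ring
  have hsuccw : 2 ^ (l + 1) < 2 ^ w := Nat.pow_lt_pow_right (by norm_num) (by omega)
  have h2 : 2 < 2 ^ w := by omega
  have hz' := hz
  rw [mul_add, mul_one] at hz'
  have hadd := eval_add hload (eval_const (show 1 < 2 ^ w by omega)) (by omega)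
  have hxor : (bin .xor (load (const 0)) (load (const 0) + const 1)).eval w D env =
      2 ^ (l + 1) - 1 := by
    change (load (const 0)).eval w D env ^^^ (load (const 0) + const 1).eval w D env = _
    rw [hadd, hload, xor_succ_of_trailing_ones]
  have hpow : headerPow.eval w D env = 2 ^ l := by
    have := eval_div (eval_add hxor (eval_const (show 1 < 2 ^ w by omega)) (by omega))
      (eval_const h2)
    rw [headerPow, this]
    omega
  have hdiv : (load (const 0) / (headerPow * const 2)).eval w D env = z := by
    rw [eval_div hload (eval_mul hpow (eval_const h2) (by omega)), ← pow_succ,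
      Nat.add_mul_div_left _ _ (by positivity), Nat.div_eq_of_lt (by omega), zero_add]
  refine ⟨hpow, ?_, ?_⟩
  · rw [headerFst, eval_mod hdiv hpow, hz1]
  · rw [headerSnd, eval_mod (eval_div hdiv hpow) hpow, hz2]

end Header

/-- The number of elements in the blocks of the first level. -/
def blockSize : Expr := headerFst * headerSnd

/-- The first element of the first-level block. -/
def fstSample (q i : Expr) : Expr := sample 1 q blockSize headerSnd (const 0) i

/-- The first element of the second-level block. -/
def sndSample (q i : Expr) : Expr :=
  sample 4 q headerFst (const 3 * headerFst) (fstSample q i) i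

/-- `windowWidth`. -/
def width : Expr := headerFst + headerFst * (const 3 * headerFst)

/-- The part of the unary code that begins with the second-level block. -/
def window (q i : Expr) : Expr :=
  read (const 7 * q + (sndSample q i + headerFst * (i / headerFst))) width

/-- The position of the bit for element `i` in the window, from the lookup table. -/
def lookup (q i : Expr) : Expr :=
  read (const 8 * q + width * (window q i * headerPow + i % headerFst)) width

/-- The element `i` of the stored sequence. -/
def access (q i : Expr) : Expr :=
  ite (sparseFlag 1 q blockSize i) (sparseEntry 1 q blockSize headerSnd (const 0) i)
    (ite (sparseFlag 4 q headerFst i)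
      (sparseEntry 4 q headerFst (const 3 * headerFst) (fstSample q i) i)
      (sndSample q i + lookup q i - i % headerFst))

/-- The second-level lookup in blocks that are not sparse. -/
lemma eval_lookup {w Q : ℕ} {D : List Bool} {env : Fin 5 → ℕ} {q i : Expr} {l vi : ℕ}
    {G : ℕ → ℕ} (hG : Monotone G) (hw : 0 < w) (henv : env 4 = w) (hQw : 20 * Q < 2 ^ w)
    (hQ : 20 ≤ Q) (hq : q.eval w D env = Q) (hi : i.eval w D env = vi)
    (hl : 0 < l) (hpow : headerPow.eval w D env = 2 ^ l) (hfst : headerFst.eval w D env = l)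
    (hsample : (sndSample q i).eval w D env = G (vi / l * l))
    (hD7 : ∀ p < Q, D.getD (7 * Q + p) false = unaryBits G p)
    (hD8 : ∀ p < Q, D.getD (8 * Q + p) false = fieldBits (windowWidth l) (fun idx =>
      Nat.nth (fun j => (idx / 2 ^ l).testBit j = true) (idx % 2 ^ l)) p)
    (hT : windowWidth l * 2 ^ (windowWidth l + l) ≤ Q) (hviQ : 4 * vi ≤ Q)
    (hGQ : 4 * G (vi / l * l) ≤ Q) (hdense : ¬ IsSparse G l (3 * l) (vi / l)) :
    (lookup q i).eval w D env = G vi + vi - (G (vi / l * l) + l * (vi / l)) := by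
  classical
  set t := windowWidth l with ht
  have ht' : t = l + l * (3 * l) := rfl
  have ht1 : 1 ≤ t := by omega
  have hpt : 2 ^ t ≤ Q := by
    refine le_trans ?_ hT
    rw [pow_add]
    calc 2 ^ t = 1 * (2 ^ t * 1) := by ring
      _ ≤ t * (2 ^ t * 2 ^ l) :=
        Nat.mul_le_mul ht1 (Nat.mul_le_mul_left _ Nat.one_le_two_pow)
  have htw : t < w := (Nat.pow_lt_pow_iff_right (by norm_num)).1 (show 2 ^ t < 2 ^ w by omega)
  have htQ : 2 * t ≤ Q := by
    refine le_trans ?_ hT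
    rw [mul_comm]
    refine Nat.mul_le_mul_left _ ?_
    calc 2 = 2 ^ 1 := rfl
      _ ≤ _ := Nat.pow_le_pow_right (by norm_num) (by omega)
  have hllt : l < 2 ^ l := l.lt_two_pow_self
  have hwidth : width.eval w D env = t :=
    eval_add hfst (eval_mul hfst (eval_mul (eval_const (by omega)) hfst
      (by nlinarith)) (by omega)) (by omega)
  have hml : vi % l < l := Nat.mod_lt _ hl
  have hkl : l * (vi / l) ≤ vi := Nat.mul_div_le vi l
  have hkl' : vi / l * l = l * (vi / l) := mul_comm _ _
  have hdm := Nat.div_add_mod vi l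
  -- the window
  obtain ⟨h1, h2⟩ := eval_segment_pos (a := 7) hQw hQ hq (by norm_num)
    (eval_add hsample (eval_mul hfst (eval_div hi hfst) (by omega)) (by omega)) (by omega)
  have hwin : (window q i).eval w D env =
      bitField D (7 * Q + (G (vi / l * l) + l * (vi / l))) t :=
    eval_read hw henv h1 hwidth h2 htw
  set x := bitField D (7 * Q + (G (vi / l * l) + l * (vi / l))) t with hx
  have hxt : x < 2 ^ t := bitField_lt _ _ _
  -- The window starts at the one of element (vi / l) · l, whose unary position is its value plus
  -- its index.
  have hbits : ∀ j < t, x.testBit j = true ↔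
      ∃ i', (fun i => G i + i) i' = (fun i => G i + i) (vi / l * l) + j := by
    intro j hj
    rw [hx, testBit_bitField, add_assoc, hD7 _ (by omega), unaryBits]
    simp [hj, hkl', add_assoc]
  -- the position of the element in it
  have hmono : G (vi / l * l) ≤ G vi := hG (by omega)
  have hspan : G vi < G (vi / l * l) + l * (3 * l) := by
    have h3 : G vi ≤ G ((vi / l + 1) * l) := hG (by rw [add_mul, one_mul]; omega)
    unfold IsSparse at hdense
    omega
  obtain ⟨j, hj⟩ : ∃ j, G vi + vi = G (vi / l * l) + vi / l * l + j :=
    ⟨G vi + vi - (G (vi / l * l) + vi / l * l), by omega⟩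
  -- Fewer than 3l² zeros and fewer than l ones separate the two positions; this is the choice of
  -- `windowWidth`.
  have hjt : j < t := by omega
  have hstrict : StrictMono fun i => G i + i := hG.add_strictMono strictMono_id
  have hnth := nth_window hstrict hbits hj hjt
  -- the table
  have hidx : x * 2 ^ l + vi % l < 2 ^ (t + l) := by
    rw [pow_add]
    have : (x + 1) * 2 ^ l ≤ 2 ^ t * 2 ^ l := Nat.mul_le_mul_right _ hxt
    rw [add_mul, one_mul] at this
    omega
  have hidx1 : t * (x * 2 ^ l + vi % l + 1) ≤ Q := (Nat.mul_le_mul_left _ hidx).trans hT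
  have hidx2 : t * (x * 2 ^ l + vi % l) ≤ Q :=
    (Nat.mul_le_mul_left _ (Nat.le_succ _)).trans hidx1
  have hidx3 : x * 2 ^ l + vi % l ≤ Q := (Nat.le_mul_of_pos_left _ ht1).trans hidx2
  obtain ⟨h3, h4⟩ := eval_segment_pos (a := 8) hQw hQ hq (by norm_num)
    (eval_mul hwidth (eval_add (eval_mul hwin hpow (by omega)) (eval_mod hi hfst) (by omega))
      (by omega)) hidx2
  rw [lookup, eval_read hw henv h3 hwidth h4 htw, bitField_fieldBits hD8 hidx1]
  have hq1 : (x * 2 ^ l + vi % l) / 2 ^ l = x := by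
    rw [mul_comm, Nat.mul_add_div (by positivity), Nat.div_eq_of_lt (by omega), add_zero]
  have hq2 : (x * 2 ^ l + vi % l) % 2 ^ l = vi % l := by
    rw [mul_comm, Nat.mul_add_mod, Nat.mod_eq_of_lt (by omega)]
  have hsub : vi - vi / l * l = vi % l := by omega
  rw [hsub] at hnth
  rw [hq1, hq2, hnth, Nat.mod_eq_of_lt (hjt.trans t.lt_two_pow_self)]
  omega

/-- Constant-time access to a monotone sequence. -/
theorem eval_access {w N Q : ℕ} {env : Fin 5 → ℕ} {q i : Expr} {l L vi : ℕ} {G : ℕ → ℕ}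
    (rest : List Bool) (hG : Monotone G) (hGN : ∀ k, G k ≤ N) (hvi : vi < N)
    (henv : env 4 = w) (henvlt : ∀ i, env i < 2 ^ w) (hQw : 20 * Q < 2 ^ w) (hNQ : 20 * N ≤ Q)
    (hT : windowWidth l * 2 ^ (windowWidth l + l) ≤ Q) (hl0 : 0 < l) (hL0 : 0 < L)
    (hlL : l ≤ L) (hLN : L ≤ N) (hL : L < 2 ^ l) (hN : N < 2 ^ L) (hLw : L < w)
    (hq : q.eval w (concatSegments 9 Q (monotoneSegments G l L) ++ rest) env = Q)
    (hi : i.eval w (concatSegments 9 Q (monotoneSegments G l L) ++ rest) env = vi) :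
    (access q i).eval w (concatSegments 9 Q (monotoneSegments G l L) ++ rest) env = G vi := by
  classical
  set D := concatSegments 9 Q (monotoneSegments G l L) ++ rest
  have hD : ∀ a < 9, ∀ p < Q, D.getD (a * Q + p) false = monotoneSegments G l L a p :=
    fun a ha p hp => getD_concatSegments _ _ ha hp
  have hGQ : ∀ k, G k ≤ Q := fun k => (hGN k).trans (by omega)
  have hw : 1 < w := by omega
  have hQ : 20 ≤ Q := by omega
  have ht : windowWidth l = l + l * (3 * l) := rfl
  have h3l : 3 * l ≤ l * (3 * l) := Nat.le_mul_of_pos_left _ hl0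
  have hpt : 2 ^ windowWidth l ≤ Q := by
    refine le_trans ?_ hT
    rw [pow_add]
    calc 2 ^ windowWidth l = 1 * (2 ^ windowWidth l * 1) := by ring
      _ ≤ windowWidth l * (2 ^ windowWidth l * 2 ^ l) :=
        Nat.mul_le_mul (by omega) (Nat.mul_le_mul_left _ Nat.one_le_two_pow)
  have htw : windowWidth l < w :=
    (Nat.pow_lt_pow_iff_right (by norm_num)).1 (show 2 ^ windowWidth l < 2 ^ w by omega)
  have htQ : windowWidth l < Q := (Nat.lt_two_pow_self).trans_le hpt
  obtain ⟨hpow, hfst, hsnd⟩ := eval_header (w := w) (D := D) (env := env) (l := l) (L := L)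
    (fun p hp => by
      have := hD 0 (by norm_num) p (by omega)
      rwa [zero_mul, zero_add] at this) hL hl0 (by omega)
  have hllt : l < 2 ^ l := l.lt_two_pow_self
  have hsize_pos : 0 < l * L := Nat.mul_pos hl0 hL0
  have hlL' : l * L < 2 ^ w := by
    have : l * L ≤ 2 ^ l * 2 ^ l := Nat.mul_le_mul hllt.le hL.le
    rw [← pow_add] at this
    exact this.trans_lt (Nat.pow_lt_pow_right (by norm_num) (by omega))
  have hsize : blockSize.eval w D env = l * L := eval_mul hfst hsnd hlL'
  have h3 : (const 3 * headerFst).eval w D env = 3 * l :=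
    eval_mul (eval_const (by omega)) hfst (by omega)
  -- first level
  have hbase0 : (const 0).eval w D env = (fun _ : ℕ => 0) (vi / (l * L)) := Nat.zero_mod _
  have hfsample : (fstSample q i).eval w D env = G (vi / (l * L) * (l * L)) := by
    refine eval_sample (b := fun _ => 0) (by omega) henv hQw hQ hq hsize hsnd hi hbase0
      (by norm_num) (hD 1 (by norm_num)) hLw ?_ (Nat.zero_le _)
      ((Nat.sub_le _ _).trans_lt ((hGN _).trans_lt hN)) (hGQ _)
    have h4 : vi / (l * L) * (l * L) ≤ vi := Nat.div_mul_le_self _ _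
    have h5 : L * (vi / (l * L)) ≤ vi / (l * L) * (l * L) := by
      rw [mul_comm]; exact Nat.mul_le_mul_left _ (Nat.le_mul_of_pos_left _ hl0)
    rw [mul_add]
    omega
  have hflag1 := eval_sparseFlag (seg := 1) (p := IsSparse G (l * L) L) hw henv hQw hQ hq hsize hi
    (by norm_num) (by omega) (hD 2 (by norm_num))
  rw [access, eval_ite (by omega) henvlt hflag1]
  split_ifs with hsp1
  · exact eval_sparseEntry (b := fun _ => 0) (by omega) henv hQw hQ hq hsize hsnd hi hbase0
      (by norm_num) hfsample (hD 3 (by norm_num)) hG hsize_pos hLw (Nat.zero_le _)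
      ((Nat.sub_le _ _).trans_lt ((hGN _).trans_lt hN)) hGQ hsp1
  -- second level
  have hdd : vi / l / L = vi / (l * L) := Nat.div_div_eq_div_mul _ _ _
  have hbase1 : (fstSample q i).eval w D env =
      (fun k => G (k / L * (l * L))) (vi / l) := by
    simp only [hfsample, hdd]
  have hle1 : vi / (l * L) * (l * L) ≤ vi / l * l := by
    rw [← hdd, mul_comm l L, ← mul_assoc]
    exact Nat.mul_le_mul_right _ (Nat.div_mul_le_self _ _)
  have hle2 : vi / l * l ≤ vi := Nat.div_mul_le_self _ _
  have hbG : G (vi / l / L * (l * L)) ≤ G (vi / l * l) := hG (by rw [hdd]; exact hle1)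
  have hGvi : G (vi / l * l) ≤ G vi := hG hle2
  -- The first-level block is dense, so its span is below lL · L, and both l and L are below 2^l:
  -- hence the 3l bits of the second level.
  have hspan : G vi - G (vi / l / L * (l * L)) < 2 ^ (3 * l) := by
    have h4 : G vi ≤ G ((vi / (l * L) + 1) * (l * L)) :=
      hG (by rw [mul_comm]; exact (Nat.lt_mul_div_succ vi hsize_pos).le)
    have h5 : l * L * L ≤ 2 ^ (3 * l) := by
      calc l * L * L ≤ 2 ^ l * 2 ^ l * 2 ^ l :=
            Nat.mul_le_mul (Nat.mul_le_mul hllt.le hL.le) hL.le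
        _ = 2 ^ (3 * l) := by ring
    unfold IsSparse at hsp1
    rw [hdd]
    omega
  have hssample : (sndSample q i).eval w D env = G (vi / l * l) := by
    refine eval_sample (b := fun k => G (k / L * (l * L))) (by omega) henv hQw hQ hq hfst h3 hi
      hbase1 (by norm_num) (hD 4 (by norm_num)) (by omega) ?_ hbG
      ((Nat.sub_le_sub_right hGvi _).trans_lt hspan) (hGQ _)
    have h5 : 3 * l * (vi / l + 1) = 3 * (vi / l * l) + 3 * l := by ring
    omega
  have hflag2 := eval_sparseFlag (seg := 4) (p := IsSparse G l (3 * l)) hw henv hQw hQ hq hfst hi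
    (by norm_num) (by omega) (hD 5 (by norm_num))
  rw [eval_ite (by omega) henvlt hflag2]
  split_ifs with hsp2
  · exact eval_sparseEntry (b := fun k => G (k / L * (l * L))) (by omega) henv hQw hQ hq hfst h3
      hi hbase1 (by norm_num) hssample (hD 6 (by norm_num)) hG hl0 (by omega) (hbG.trans hGvi)
      hspan hGQ hsp2
  -- lookup table
  have hGk := hGN (vi / l * l)
  have hGi := hGN vi
  have hlook := eval_lookup hG (by omega) henv hQw hQ hq hi hl0 hpow hfst hssample
    (hD 7 (by norm_num)) (hD 8 (by norm_num)) hT (by omega) (by omega) hsp2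
  have hdm := Nat.div_add_mod vi l
  rw [eval_sub (eval_add hssample hlook (by omega)) (eval_mod hi hfst) (by omega)
    (by omega)]
  rw [mul_comm] at hle2
  omega

end WordRAM.Expr

/-! ### The columns of an array and the codes of the boundaries -/

/-- The first index at which column `r` of `A` is at least `k`, or `n`; `0` for `n ≤ r`. -/
noncomputable def firstGE {n : ℕ} (A : Fin n → Fin n → ℕ) (k r : ℕ) : ℕ :=
  if hr : r < n then sInf {y | ∀ hy : y < n, k ≤ A ⟨r, hr⟩ ⟨y, hy⟩} else 0

section Columns

variable {n m : ℕ} {A : Fin n → Fin n → ℕ} {k r x : ℕ}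

lemma IMS2.monotone_right (hA : A ∈ IMS2 n m) (i : Fin n) : Monotone (A i) := by
  intro j j' hjj
  obtain ⟨j, hj⟩ := j
  obtain ⟨j', hj'⟩ := j'
  replace hjj : j ≤ j' := hjj
  induction j', hjj using Nat.le_induction with
  | base => exact le_rfl
  | succ a _ ih => exact (ih (by omega)).trans (hA.1 i ⟨a, by omega⟩ hj')

lemma IMS2.le_of_le_left (hA : A ∈ IMS2 n m) (j : Fin n) : Monotone fun i => A i j := by
  intro i i' hii
  obtain ⟨i, hi⟩ := i
  obtain ⟨i', hi'⟩ := i'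
  replace hii : i ≤ i' := hii
  induction i', hii using Nat.le_induction with
  | base => exact le_rfl
  | succ a _ ih => exact (ih (by omega)).trans (hA.2.1 ⟨a, by omega⟩ j hi')

lemma firstGE_le (A : Fin n → Fin n → ℕ) (k r : ℕ) : firstGE A k r ≤ n := by
  rw [firstGE]
  split_ifs with hr
  · exact Nat.sInf_le fun hy => absurd hy (lt_irrefl n)
  · exact Nat.zero_le n

lemma le_firstGE_apply (hr : r < n) (hy : firstGE A k r < n) :
    k ≤ A ⟨r, hr⟩ ⟨firstGE A k r, hy⟩ := by
  have h : firstGE A k r ∈ {y | ∀ hy : y < n, k ≤ A ⟨r, hr⟩ ⟨y, hy⟩} := by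
    rw [firstGE, dif_pos hr]
    exact Nat.sInf_mem ⟨n, fun hy => absurd hy (lt_irrefl n)⟩
  exact h hy

lemma apply_lt_iff (hA : A ∈ IMS2 n m) (hr : r < n) (hx : x < n) :
    A ⟨r, hr⟩ ⟨x, hx⟩ < k ↔ x < firstGE A k r := by
  constructor
  · intro h
    by_contra! hle
    have h1 := le_firstGE_apply (A := A) (k := k) hr (hle.trans_lt hx)
    have h2 := IMS2.monotone_right hA ⟨r, hr⟩
      (show (⟨firstGE A k r, hle.trans_lt hx⟩ : Fin n) ≤ ⟨x, hx⟩ from hle)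
    omega
  · intro h
    rw [firstGE, dif_pos hr] at h
    have := Nat.notMem_of_lt_sInf h
    simp only [Set.mem_ofPred_eq, not_forall, not_le] at this
    exact this.2

/-- This is where monotonicity in the column number enters: it makes the heights of the horizontal
edges descend. -/
lemma firstGE_antitone (hA : A ∈ IMS2 n m) (k : ℕ) : Antitone (firstGE A k) := by
  intro r r' hrr
  by_cases hr' : r' < n
  · by_contra! hlt
    have hx : firstGE A k r < n := hlt.trans_le (firstGE_le A k r')
    have h1 := le_firstGE_apply (hrr.trans_lt hr') hx
    have h2 := (apply_lt_iff hA hr' hx).2 hlt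
    have h3 := IMS2.le_of_le_left hA ⟨firstGE A k r, hx⟩
      (show (⟨r, hrr.trans_lt hr'⟩ : Fin n) ≤ ⟨r', hr'⟩ from hrr)
    simp only at h3
    omega
  · rw [firstGE, dif_neg hr']
    exact Nat.zero_le _

lemma isFirstGE_firstGE (hA : A ∈ IMS2 n m) (r : Fin n) (k : ℕ) :
    IsFirstGE A r k (firstGE A k r) := by
  constructor
  · rintro ⟨x, hx⟩
    have hle : firstGE A k r ≤ x := by
      by_contra! h
      exact absurd ((apply_lt_iff hA r.2 x.2).2 h) (not_lt.2 hx)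
    refine ⟨⟨hle.trans_lt x.2, le_firstGE_apply r.2 _⟩, ?_⟩
    rintro y ⟨hy, hky⟩
    by_contra! h
    exact absurd ((apply_lt_iff hA r.2 hy).2 h) (not_lt.2 hky)
  · intro h
    by_contra hne
    exact h ⟨_, le_firstGE_apply r.2 ((firstGE_le A k r).lt_of_ne hne)⟩

lemma IsFirstGE.unique {r : Fin n} {y z : ℕ} (hy : IsFirstGE A r k y) (hz : IsFirstGE A r k z) :
    y = z := by
  by_cases h : ∃ x : Fin n, k ≤ A r x
  · exact (hy.1 h).unique (hz.1 h)
  · rw [hy.2 h, hz.2 h]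

/-- The padding agrees with the conventions of `firstGE`: the value 0 for columns r ≥ n corresponds
to the padding m ≥ k there, so column n needs no special treatment. -/
lemma padded_lt_iff (hA : A ∈ IMS2 n m) (hk : k < m) (r : ℕ) {y : ℤ} (hy : -1 ≤ y) :
    padded m A r y < k ↔ y < firstGE A k r := by
  rw [padded]
  rcases hy.eq_or_lt with rfl | hy
  · simp only [show ((-1 : ℤ) < 0) from by norm_num, or_true, if_true]
    omega
  lift y to ℕ using by omega
  rw [if_neg (by omega)]
  simp only [Int.toNat_natCast, Nat.cast_lt]
  split_ifs with h
  · rw [Nat.cast_lt, apply_lt_iff hA h.1 h.2]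
  · rw [Nat.cast_lt]
    have : firstGE A k r ≤ y := by
      by_cases hr : r < n
      · exact (firstGE_le A k r).trans (by omega)
      · rw [firstGE, dif_neg hr]; exact Nat.zero_le y
    omega

end Columns

/-! ### Lattice paths given by the heights of their horizontal steps. -/

/-- The bit string of the path from height `j` to height `0` whose steps to the right are at the
given heights. -/
def pathCode : ℕ → List ℕ → List Bool
  | j, [] => List.replicate j false
  | j, a :: l => List.replicate (j - a) false ++ true :: pathCode a l

lemma count_true_pathCode (j : ℕ) (l : List ℕ) : (pathCode j l).count true = l.length := by
  induction l generalizing j with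
  | nil => simp [pathCode, List.count_replicate]
  | cons a l ih => simp [pathCode, List.count_replicate, ih]

lemma count_false_pathCode {j : ℕ} {l : List ℕ} (h : (j :: l).Pairwise (· ≥ ·)) :
    (pathCode j l).count false = j := by
  induction l generalizing j with
  | nil => simp [pathCode]
  | cons a l ih =>
    have ha : a ≤ j := List.rel_of_pairwise_cons h (by simp)
    simp [pathCode, ih (List.pairwise_cons.1 h).2, ha]

lemma length_pathCode {j : ℕ} {l : List ℕ} (h : (j :: l).Pairwise (· ≥ ·)) :
    (pathCode j l).length = j + l.length := by
  rw [← List.count_true_add_count_false, count_true_pathCode, count_false_pathCode h, add_comm]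

lemma mem_pathEdges_replicate {e : GridEdge} (k : ℕ) (b : List Bool) (i j : ℤ) :
    e ∈ pathEdges i j (List.replicate k false ++ b) ↔
      (∃ y : ℤ, j - k ≤ y ∧ y < j ∧ e = ((i, y), (i, y + 1))) ∨ e ∈ pathEdges i (j - k) b := by
  induction k generalizing j with
  | zero =>
    simp only [List.replicate_zero, List.nil_append, Nat.cast_zero, sub_zero, iff_or_self]
    rintro ⟨y, h1, h2, -⟩
    omega
  | succ k ih =>
    rw [List.replicate_succ, List.cons_append, pathEdges, List.mem_cons, ih, ← or_assoc]
    have hj : j - 1 - (k : ℤ) = j - ((k + 1 : ℕ) : ℤ) := by push_cast; ring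
    rw [hj]
    refine or_congr_left ⟨?_, ?_⟩
    · rintro (rfl | ⟨y, h1, h2, rfl⟩)
      · exact ⟨j - 1, by push_cast; omega, by omega, by rw [sub_add_cancel]⟩
      · exact ⟨y, h1, by omega, rfl⟩
    · rintro ⟨y, h1, h2, rfl⟩
      rcases eq_or_ne y (j - 1) with rfl | hne
      · left; rw [sub_add_cancel]
      · exact Or.inr ⟨y, h1, by omega, rfl⟩

/-- On the t-th vertical line the path descends from the previous height to the next one. The
default 0 of `getD` at t = `l.length` provides the final descent to the axis. -/
lemma mem_pathEdges_pathCode {e : GridEdge} {j : ℕ} {l : List ℕ}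
    (h : (j :: l).Pairwise (· ≥ ·)) (i : ℤ) :
    e ∈ pathEdges i j (pathCode j l) ↔
      (∃ t < l.length, e = ((i + t, (l.getD t 0 : ℤ)), (i + t + 1, (l.getD t 0 : ℤ)))) ∨
      (∃ t ≤ l.length, ∃ y : ℤ, (l.getD t 0 : ℤ) ≤ y ∧ y < ((j :: l).getD t 0 : ℕ) ∧
        e = ((i + t, y), (i + t, y + 1))) := by
  induction l generalizing i j with
  | nil =>
    have := mem_pathEdges_replicate (e := e) j [] i j
    rw [List.append_nil] at this
    simp [pathCode, this, pathEdges]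
  | cons a l ih =>
    have ha : a ≤ j := List.rel_of_pairwise_cons h (by simp)
    have hcast : (j : ℤ) - ((j - a : ℕ) : ℤ) = a := by omega
    rw [pathCode, mem_pathEdges_replicate, hcast, pathEdges, List.mem_cons,
      ih (List.pairwise_cons.1 h).2]
    constructor
    · rintro (⟨y, h1, h2, rfl⟩ | rfl | ⟨t, ht, rfl⟩ | ⟨t, ht, y, h1, h2, rfl⟩)
      · exact Or.inr ⟨0, Nat.zero_le _, y, by simpa using h1, by simpa using h2, by simp⟩
      · exact Or.inl ⟨0, by simp, by simp⟩
      · exact Or.inl ⟨t + 1, by simpa using ht, by simp [add_comm, add_left_comm]⟩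
      · exact Or.inr ⟨t + 1, by simpa using ht, y, by simpa using h1, by simpa using h2,
          by simp [add_comm, add_left_comm]⟩
    · rintro (⟨_ | t, ht, rfl⟩ | ⟨_ | t, ht, y, h1, h2, rfl⟩)
      · exact Or.inr (Or.inl (by simp))
      · exact Or.inr (Or.inr (Or.inl ⟨t, by simpa using ht,
          by simp [add_comm, add_left_comm]⟩))
      · exact Or.inl ⟨y, by simpa using h1, by simpa using h2, by simp⟩
      · exact Or.inr (Or.inr (Or.inr ⟨t, by simpa using ht, y, by simpa using h1,
          by simpa using h2, by simp [add_comm, add_left_comm]⟩))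

/-- The zeros before a one are exactly the downward steps taken from height j to the height of that
horizontal step. -/
lemma exists_pathCode_eq_append {j : ℕ} {l : List ℕ} (h : (j :: l).Pairwise (· ≥ ·)) {t : ℕ}
    (ht : t < l.length) :
    ∃ pre post, pathCode j l = pre ++ true :: post ∧ pre.count true = t ∧
      pre.count false + l.getD t 0 = j := by
  induction l generalizing j t with
  | nil => simp at ht
  | cons a l ih =>
    have ha : a ≤ j := List.rel_of_pairwise_cons h (by simp)
    cases t with
    | zero => exact ⟨_, _, rfl, by simp [List.count_replicate], by simp [ha]⟩
    | succ t =>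
      obtain ⟨pre, post, h1, h2, h3⟩ :=
        ih (List.pairwise_cons.1 h).2 (t := t) (by simpa using ht)
      refine ⟨List.replicate (j - a) false ++ true :: pre, post, by simp [pathCode, h1],
        by simp [List.count_replicate, h2], ?_⟩
      simp only [List.count_append, List.count_replicate_self, List.getD_cons_succ]
      rw [List.count_cons_of_ne (by simp)]
      omega

lemma bitSelect_append {pre post : List Bool} :
    bitSelect true (pre ++ true :: post) (pre.count true + 1) = pre.length + 1 := by
  have hmem : bitRank true (pre ++ true :: post) (pre.length + 1) = pre.count true + 1 := by
    simp [bitRank, List.take_append, List.take_of_length_le]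
  refine le_antisymm (Nat.sInf_le hmem) (le_csInf ⟨_, hmem⟩ fun p hp => ?_)
  by_contra! hlt
  have h1 : bitRank true (pre ++ true :: post) p ≤ pre.count true := by
    rw [bitRank, List.take_append_of_le_length (by omega)]
    exact (List.take_sublist p pre).count_le true
  simp only [Set.mem_ofPred_eq] at hp
  omega

/-! ### The boundary as a path, and its rank/select formula. -/

section Boundary

variable {n m : ℕ} {A : Fin n → Fin n → ℕ} {k : ℕ}

/-- The code of the `k`-th boundary. -/
noncomputable def boundaryCode (A : Fin n → Fin n → ℕ) (k : ℕ) : List Bool :=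
  pathCode n ((List.range n).map (firstGE A k))

lemma getD_map_firstGE (A : Fin n → Fin n → ℕ) (k t : ℕ) :
    ((List.range n).map (firstGE A k)).getD t 0 = firstGE A k t := by
  by_cases ht : t < n
  · simp [ht]
  · simp [ht, firstGE]

lemma pairwise_map_firstGE (hA : A ∈ IMS2 n m) (k : ℕ) :
    (n :: (List.range n).map (firstGE A k)).Pairwise (· ≥ ·) := by
  refine List.pairwise_cons.2 ⟨fun a ha => ?_, ?_⟩
  · obtain ⟨r, -, rfl⟩ := List.mem_map.1 ha
    exact firstGE_le A k r
  · rw [List.pairwise_map]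
    exact List.pairwise_lt_range.imp fun h => firstGE_antitone hA k h.le

lemma length_boundaryCode (hA : A ∈ IMS2 n m) (k : ℕ) : (boundaryCode A k).length = 2 * n := by
  rw [boundaryCode, length_pathCode (pairwise_map_firstGE hA k)]
  simp [two_mul]

/-- By `padded_lt_iff`, column i has its only horizontal boundary edge at height `firstGE A k i`,
and the vertical ones on line i fill the gap up to the height of column i - 1, or up to n for i = 0,
where the padding is -1. -/
lemma isBoundaryCode_boundaryCode (hA : A ∈ IMS2 n m) (hk : k < m) :
    IsBoundaryCode m A k (boundaryCode A k) := by
  refine ⟨length_boundaryCode hA k, ?_⟩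
  ext e
  rw [Set.mem_ofPred_eq, boundaryCode, mem_pathEdges_pathCode (pairwise_map_firstGE hA k),
    boundary, Set.mem_union, Set.mem_ofPred_eq, Set.mem_ofPred_eq]
  simp only [getD_map_firstGE, List.length_map, List.length_range, zero_add]
  refine or_congr ⟨?_, ?_⟩ ⟨?_, ?_⟩
  · rintro ⟨t, ht, rfl⟩
    have hle := firstGE_le A k t
    refine ⟨t, firstGE A k t, by omega, by omega, rfl, ?_, ?_⟩
    · rw [padded_lt_iff hA hk t (by omega)]; omega
    · rw [← not_lt, padded_lt_iff hA hk t (by omega)]; omega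
  · rintro ⟨i, j, hi, hj, rfl, h1, h2⟩
    lift i to ℕ using hi.1
    rw [padded_lt_iff hA hk i (by omega)] at h1
    rw [← not_lt, padded_lt_iff hA hk i (by omega)] at h2
    obtain rfl : j = firstGE A k i := by omega
    exact ⟨i, by omega, rfl⟩
  · rintro ⟨t, ht, y, h1, h2, rfl⟩
    have hlt : y < n ∧ padded m A ((t : ℤ) - 1) y < k := by
      cases t with
      | zero =>
        refine ⟨by simpa using h2, ?_⟩
        rw [padded, if_pos (by simp)]
        omega
      | succ t =>
        rw [List.getD_cons_succ, getD_map_firstGE] at h2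
        have := firstGE_le A k t
        refine ⟨by omega, ?_⟩
        rw [Nat.cast_succ, add_sub_cancel_right, padded_lt_iff hA hk t (by omega)]
        exact h2
    refine ⟨t, y, by omega, by omega, rfl, hlt.2, ?_⟩
    rw [← not_lt, padded_lt_iff hA hk t (by omega)]
    omega
  · rintro ⟨i, j, hi, hj, rfl, h1, h2⟩
    lift i to ℕ using hi.1
    rw [← not_lt, padded_lt_iff hA hk i (by omega)] at h2
    refine ⟨i, by omega, j, by omega, ?_, rfl⟩
    cases i with
    | zero => simpa using hj.2
    | succ i =>
      rw [Nat.cast_succ, add_sub_cancel_right, padded_lt_iff hA hk i (by omega)] at h1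
      rwa [List.getD_cons_succ, getD_map_firstGE]

lemma firstGE_add_bitRank (hA : A ∈ IMS2 n m) (r : Fin n) (k : ℕ) :
    firstGE A k r + bitRank false (boundaryCode A k)
      (bitSelect true (boundaryCode A k) (r + 1)) = n := by
  obtain ⟨pre, post, h1, h2, h3⟩ := exists_pathCode_eq_append (pairwise_map_firstGE hA k)
    (t := r) (by simp)
  rw [getD_map_firstGE] at h3
  rw [boundaryCode, h1, ← h2, bitSelect_append, h2]
  have : bitRank false (pre ++ true :: post) (pre.length + 1) = pre.count false := by
    simp [bitRank, List.take_append, List.take_of_length_le]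
  omega

end Boundary

/-! ### The data structure for the array -/

/-- With t the window width, the exponent 2t + l is quadratic in l, while 2^(l-1) ≤ L and 2^(L-1) ≤
N; so it is at most L - 1 up to an additive constant. -/
lemma exists_table_bound : ∃ M, 20 ≤ M ∧ ∀ N, 0 < N →
    windowWidth N.size.size * 2 ^ (windowWidth N.size.size + N.size.size) ≤ M * N := by
  have hexp : ∃ K, ∀ l, 0 < l → 2 * windowWidth l + l + 1 ≤ 2 ^ (l - 1) + K := by
    -- The quadratic 6l² + 3l + 1 exceeds 2^(l-1) by at most 281, at l = 8; from l = 12 on the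
    -- exponential wins by induction.
    refine ⟨300, fun l hl => ?_⟩
    rcases Nat.lt_or_ge l 12 with h | h
    · interval_cases l <;> norm_num [windowWidth]
    · induction l, h using Nat.le_induction with
      | base => norm_num [windowWidth]
      | succ l hl ih =>
        have h1 := ih (by omega)
        obtain ⟨k, rfl⟩ : ∃ k, l = k + 1 := ⟨l - 1, by omega⟩
        simp only [Nat.add_sub_cancel, windowWidth] at h1 ⊢
        rw [pow_succ]
        nlinarith
  obtain ⟨K, hK⟩ := hexp
  -- The factor 20 is not needed for the table; it secures M ≥ 20 and so segments of at least 20N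
  -- bits.
  refine ⟨20 * 2 ^ K, Nat.le_mul_of_pos_right _ (by positivity), fun N hN => ?_⟩
  have hL : 0 < N.size := Nat.size_pos.2 hN
  have hl : 0 < N.size.size := Nat.size_pos.2 hL
  have h1 : 2 ^ (N.size - 1) ≤ N := Nat.lt_size.1 (by omega)
  have h2 : 2 ^ (N.size.size - 1) ≤ N.size := Nat.lt_size.1 (by omega)
  have h3 := hK _ hl
  set t := windowWidth N.size.size
  calc t * 2 ^ (t + N.size.size) ≤ 2 ^ t * 2 ^ (t + N.size.size) :=
        Nat.mul_le_mul_right _ Nat.lt_two_pow_self.le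
    _ = 2 ^ (2 * t + N.size.size) := by rw [← pow_add]; congr 1; ring
    _ ≤ 2 ^ (K + (N.size - 1)) := Nat.pow_le_pow_right (by norm_num) (by omega)
    _ = 2 ^ K * 2 ^ (N.size - 1) := pow_add _ _ _
    _ ≤ 20 * 2 ^ K * N := Nat.mul_le_mul (by omega) h1

/-- The sequence of the numbers of zeros before the ones in the concatenation of the boundary
codes, continued by `n * m`. -/
noncomputable def zerosBefore {n : ℕ} (m : ℕ) (A : Fin n → Fin n → ℕ) (i : ℕ) : ℕ :=
  if i < n * m then i / n * n + (n - firstGE A (i / n) (i % n)) else n * m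

section ZerosBefore

variable {n m : ℕ} {A : Fin n → Fin n → ℕ}

lemma zerosBefore_le (m : ℕ) (A : Fin n → Fin n → ℕ) (i : ℕ) : zerosBefore m A i ≤ n * m := by
  rw [zerosBefore]
  split_ifs with hi
  · have h1 : i / n + 1 ≤ m := Nat.div_lt_of_lt_mul hi
    have h2 := Nat.mul_le_mul_left n h1
    rw [mul_add, mul_comm n (i / n)] at h2
    omega
  · exact le_rfl

/-- Within one boundary this is `firstGE_antitone`; between boundaries it suffices that the values
for boundary k lie in [kn, (k+1)n]. -/
lemma monotone_zerosBefore (hA : A ∈ IMS2 n m) : Monotone (zerosBefore m A) := by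
  intro i i' hii
  by_cases hi' : i' < n * m
  · rw [zerosBefore, if_pos (hii.trans_lt hi'), zerosBefore, if_pos hi']
    have hdiv : i / n ≤ i' / n := Nat.div_le_div_right hii
    rcases hdiv.eq_or_lt with h | h
    · have h1 := Nat.div_add_mod i n
      have h2 := Nat.div_add_mod i' n
      rw [h] at h1
      have h3 := firstGE_antitone hA (i' / n) (show i % n ≤ i' % n by omega)
      rw [h]
      omega
    · have h1 := Nat.mul_le_mul_right n (Nat.succ_le_of_lt h)
      rw [Nat.succ_mul] at h1
      omega
  · exact (zerosBefore_le m A i).trans (by rw [zerosBefore, if_neg hi'])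

lemma zerosBefore_apply {h : ℕ} (hh : h < m) (r : Fin n) :
    h * n + r < n * m ∧ zerosBefore m A (h * n + r) = h * n + (n - firstGE A h r) := by
  have hn : 0 < n := r.pos
  have h1 : h * n + r < n * m := by
    have := Nat.mul_le_mul_left n (Nat.succ_le_of_lt hh)
    have hr := r.2
    rw [Nat.mul_succ, mul_comm n h] at this
    omega
  refine ⟨h1, ?_⟩
  rw [zerosBefore, if_pos h1]
  have h2 : (h * n + r) / n = h := by
    rw [mul_comm, Nat.mul_add_div hn, Nat.div_eq_of_lt r.2, add_zero]
  have h3 : (h * n + r) % n = r := by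
    rw [mul_comm, Nat.mul_add_mod, Nat.mod_eq_of_lt r.2]
  rw [h2, h3]

end ZerosBefore

lemma length_concatSegments (c q : ℕ) (seg : ℕ → ℕ → Bool) :
    (concatSegments c q seg).length = c * q := by simp [concatSegments]

/-! ### Answering a query by one access. -/

namespace WordRAM.Expr

/-- The answer to a query; the inputs are the column, the value, `n`, `m` and `w`. -/
def query (M : ℕ) : Expr :=
  ite (bin .lt (var 1) (var 3))
    (var 2 + var 1 * var 2 - access (const M * (var 2 * var 3)) (var 1 * var 2 + var 0)) (var 2)

lemma eval_query {M n m w : ℕ} {A : Fin n → Fin n → ℕ} (rest : List Bool) (hA : A ∈ IMS2 n m)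
    (hM : 20 ≤ M) (hT : windowWidth (n * m).size.size *
      2 ^ (windowWidth (n * m).size.size + (n * m).size.size) ≤ M * (n * m))
    (hw : 20 * M * (n * m) < 2 ^ w) (r : Fin n) {h : ℕ} (hh : h < 2 ^ w) :
    IsFirstGE A r h ((query M).eval w (concatSegments 9 (M * (n * m))
      (monotoneSegments (zerosBefore m A) (n * m).size.size (n * m).size) ++ rest)
      fun i => [(r : ℕ), h, n, m, w].getD i 0) := by
  have hn : 0 < n := r.pos
  have hm : 0 < m := (Nat.zero_le _).trans_lt (hA.2.2 r r)
  set env : Fin 5 → ℕ := fun i => [(r : ℕ), h, n, m, w].getD i 0 with henv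
  set N := n * m with hNdef
  have hN : 0 < N := Nat.mul_pos hn hm
  have hnN : n ≤ N := Nat.le_mul_of_pos_right _ hm
  have hmN : m ≤ N := Nat.le_mul_of_pos_left _ hn
  have hL : 0 < N.size := Nat.size_pos.2 hN
  have hl : 0 < N.size.size := Nat.size_pos.2 hL
  have hQw : 20 * (M * N) < 2 ^ w := by rwa [← mul_assoc]
  have hNQ : 20 * N ≤ M * N := Nat.mul_le_mul_right _ hM
  have hMQ : M ≤ M * N := Nat.le_mul_of_pos_right _ hN
  have hpow : 2 ^ (N.size - 1) ≤ N := Nat.lt_size.1 (by omega)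
  have hsize : ∀ k : ℕ, k.size ≤ k := fun k => Nat.size_le.2 Nat.lt_two_pow_self
  have hLw : N.size < w := by
    have h1 : 2 ^ N.size = 2 * 2 ^ (N.size - 1) := by
      rw [← pow_succ']; congr 1; omega
    exact (Nat.pow_lt_pow_iff_right (show 1 < 2 by norm_num)).1 (by omega)
  have hr := r.2
  have henvlt : ∀ i, env i < 2 ^ w := by
    have := w.lt_two_pow_self
    intro i
    fin_cases i <;> simp [henv] <;> omega
  have hc : (bin .lt (var 1) (var 3)).eval w (concatSegments 9 (M * N)
      (monotoneSegments (zerosBefore m A) N.size.size N.size) ++ rest) env =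
      if h < m then 1 else 0 := rfl
  -- For h ≥ m the product h · n may wrap around, but then that branch is discarded and the answer
  -- is n, since all entries are below m.
  rw [query, eval_ite (by omega) henvlt hc]
  split_ifs with hhm
  · obtain ⟨hlt, hG⟩ := zerosBefore_apply (A := A) hhm r
    have hmul := eval_mul (w := w) (D := concatSegments 9 (M * N)
      (monotoneSegments (zerosBefore m A) N.size.size N.size) ++ rest) (env := env)
      (a := var 1) (b := var 2) (x := h) (y := n) rfl rfl (by omega)
    have hacc := eval_access (q := const M * (var 2 * var 3)) (i := var 1 * var 2 + var 0)
      rest (monotone_zerosBefore hA) (zerosBefore_le m A) hlt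
      (w := w) (env := env) rfl henvlt hQw hNQ hT hl hL (hsize _) (hsize _) (Nat.lt_size_self _)
      (Nat.lt_size_self _) hLw
      (eval_mul (eval_const (by omega)) (eval_mul rfl rfl (show n * m < 2 ^ w by omega))
        (by omega))
      (eval_add hmul rfl (show h * n + (r : ℕ) < 2 ^ w by omega))
    have hle := firstGE_le A h r
    have hsum := eval_add (a := var 2) (x := n) rfl hmul (by omega)
    rw [eval_sub hsum hacc (by omega) (by omega), hG]
    have : n + h * n - (h * n + (n - firstGE A h r)) = firstGE A h r := by omega
    rw [this]
    exact isFirstGE_firstGE hA r h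
  · have hno : ¬ ∃ x : Fin n, h ≤ A r x := by
      rintro ⟨x, hx⟩
      have := hA.2.2 r x
      omega
    exact ⟨fun hx => absurd hx hno, fun _ => rfl⟩

end WordRAM.Expr

theorem mainTheorem10 :
    ∃ (P : WordRAM.Program) (c C T : ℕ),
      ∀ (n m w : ℕ), c * (n * m) ≤ 2 ^ w →
        ∀ A ∈ IMS2 n m,
          ∃ (D : List Bool) (B : Fin m → List Bool),
            -- the structure `D` has `O(nm)` bits
            D.length ≤ C * (n * m) ∧
            -- it contains the `2n`-bit vectors of the `m` boundaries
            (∀ k : Fin m, IsBoundaryCode m A k (B k)) ∧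
            (List.ofFn B).flatten <:+: D ∧
            -- every query is answered from `D` by the program `P` in constant time
            (∀ (r : Fin n) (h : ℕ), h < 2 ^ w →
              ∃ y : ℕ,
                WordRAM.run w D P T (WordRAM.initial [r, h, n, m, w]) = some y ∧
                IsFirstGE A r h y) ∧
            -- the answer in terms of rank and select on the vectors
            (∀ (r : Fin n) (h : Fin m) (y : ℕ), IsFirstGE A r h y →
              y + bitRank false (B h) (bitSelect true (B h) (r + 1)) = n) := by
  obtain ⟨M, hM, hT⟩ := exists_table_bound
  -- The summand 1 in c makes the bound 20Mnm < 2^w strict when nm > 0. The length is nine segments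
  -- of Mnm bits plus m codes of 2n bits; the 2 in T counts the final move and halt.
  refine ⟨(WordRAM.Expr.query M).program, 20 * M + 1, 9 * M + 2,
    ((WordRAM.Expr.query M).compile 5).length + 2, fun n m w hw A hA => ?_⟩
  refine ⟨concatSegments 9 (M * (n * m))
      (monotoneSegments (zerosBefore m A) (n * m).size.size (n * m).size) ++
      (List.ofFn fun k : Fin m => boundaryCode A k).flatten,
    fun k => boundaryCode A k, ?_, fun k => isBoundaryCode_boundaryCode hA k.2,
    (List.suffix_append _ _).isInfix, fun r h hh => ?_, fun r h y hy => ?_⟩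
  · have hlen : ((List.ofFn fun k : Fin m => boundaryCode A k).flatten).length = m * (2 * n) := by
      simp [List.length_flatten, List.map_ofFn, Function.comp_def, length_boundaryCode hA]
    rw [List.length_append, length_concatSegments, hlen]
    exact le_of_eq (by ring)
  · refine ⟨_, WordRAM.Expr.run_program _ _ _ _, ?_⟩
    have hN : 0 < n * m :=
      Nat.mul_pos r.pos ((Nat.zero_le _).trans_lt (hA.2.2 r r))
    exact WordRAM.Expr.eval_query _ hA hM (hT _ hN) (by rw [add_mul] at hw; omega) r hh
  · rw [hy.unique (isFirstGE_firstGE hA r h)]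
    exact firstGE_add_bitRank hA r h
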